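/- Let $R$ be a proper subring of $\mathbb{Q}$. For $n\in\mathbb{N}$, an $n$-free-by-1 $R$-module is a non-free $R$-module isomorphic to one generated by elements $x_i$ $(i<n)$ and $y_m$ $(m\in\mathbb{N})$ subject only to relations $$p_m\,y_{m+1}=y_m+\sum_{i<n}k_{im}\,x_i\qquad(m\in\mathbb{N}),$$ where $p_m,k_{im}\in R$ and $p_m\neq 0$ for all $m$; a finite-rank-free-by-1 $R$-module is one that is $n$-free-by-1 for some $n\in\mathbb{N}$. An $R$-module is called $n$-free if all its submodules of rank $\le n$ are free. Let $\Phi$ be a nonempty set of finite-rank-free-by-1 $R$-modules. An $R$-module $L$ is $\Phi$-complete if $\operatorname{Ext}^1_R(M,L)=0$ for all $M\in\Phi$. An $R$-module $G$ is $\Phi$-represented if $G=\bigcup_{\alpha<\lambda}G_\alpha$ for some ordinal $\lambda$ and some ascending chain of submodules $G_\alpha$ with $G_0=0$, with $G_\delta=\bigcup_{\alpha<\delta}G_\alpha$ for limit ordinals $\delta<\lambda$, and such that, whenever $\alpha+1<\lambda$, the quotient $G_{\alpha+1}/G_\alpha$ is a free $R$-module or isomorphic to a member of $\Phi$. Theorem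 4.6. Let $\kappa>|\Phi|$ be an infinite regular cardinal with $\kappa^{\aleph_0}=\kappa$. Then there is a torsion-free, $\Phi$-complete, $\Phi$-represented $R$-module $G$ of rank $\kappa$ whose nucleus (the largest subring $S$ of $\mathbb{Q}$ such that the abelian group $G$ is an $S$-module) is $R$. Moreover $G$ can be chosen such that, for every $n\in\mathbb{N}$, if every member of $\Phi$ has rank at least $n+1$ and is $n$-free, then $G$ is $n$-free, that is, every $R$-submodule of $G$ of rank at most $n$ is free. -/

import Mathlib

open CategoryTheory Cardinal

universe u

/-- The `m`-th relator `p m • y (m+1) - y m - ∑ i, k i m • x i` in the free module on the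
generators `x i` (`i < n`, written `Sum.inl i`) and `y m` (`m ∈ ℕ`, written `Sum.inr m`). -/
noncomputable def freeByOneRelator {R : Type*} [CommRing R] {n : ℕ}
    (p : ℕ → R) (k : Fin n → ℕ → R) (m : ℕ) : (Fin n ⊕ ℕ) →₀ R :=
  Finsupp.single (Sum.inr (m + 1)) (p m) - Finsupp.single (Sum.inr m) 1
    - ∑ i, Finsupp.single (Sum.inl i) (k i m)

/-- `M` is an `n`-free-by-1 `R`-module (`n` finite): it is generated by `x i` (`i < n`) and `y m`
(`m ∈ ℕ`) subject only to the relations `p m • y (m+1) = y m + ∑ i, k i m • x i`, where all `p m`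
are nonzero, and it is not free. (For domains `R` that are PIDs, not being free says that
the rank-one quotient of `M` by the submodule generated by the `x i` is not isomorphic to `R`.) -/
def IsFreeByOne (R : Type*) [CommRing R] (n : ℕ) (M : Type*) [AddCommGroup M] [Module R M] :
    Prop :=
  (∃ (p : ℕ → R) (k : Fin n → ℕ → R), (∀ m, p m ≠ 0) ∧
    Nonempty (M ≃ₗ[R]
      (((Fin n ⊕ ℕ) →₀ R) ⧸ Submodule.span R (Set.range (freeByOneRelator p k))))) ∧
  ¬ Module.Free R M

/-- Every submodule of rank at most `n` is free. -/
def IsNFree (R : Type*) [CommRing R] (n : ℕ) (M : Type*) [AddCommGroup M] [Module R M] : Prop :=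
  ∀ F : Submodule R M, Module.rank R F ≤ n → Module.Free R F

/-- `R` is the nucleus of the abelian group `G`: the largest subring of `ℚ` over which `G` is
a module. -/
def IsNucleus (R : Subring ℚ) (G : Type*) [AddCommGroup G] : Prop :=
  IsGreatest {S : Subring ℚ | Nonempty (Module S G)} R

/-- `L` is `Φ`-complete: `Ext¹(M, L) = 0` for all `M ∈ Φ`. -/
def IsPhiComplete (R : Subring ℚ) (Φ : Set (ModuleCat.{u} R)) (L : ModuleCat.{u} R) : Prop :=
  ∀ M ∈ Φ, Subsingleton (Abelian.Ext M L 1)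

/-- `G` is `Φ`-represented: it is the union of an ascending continuous chain of submodules
`C α` (`α < μ`) starting at `0`, whose successive quotients are free or isomorphic to
members of `Φ`. -/
def IsPhiRepresented (R : Subring ℚ) (Φ : Set (ModuleCat.{u} R)) (G : ModuleCat.{u} R) : Prop :=
  ∃ (μ : Ordinal.{u}) (C : Ordinal.{u} → Submodule R G),
    Monotone C ∧ C 0 = ⊥ ∧ (⨆ α : Set.Iio μ, C α) = ⊤ ∧
    (∀ δ < μ, Order.IsSuccLimit δ → C δ = ⨆ α : Set.Iio δ, C α) ∧
    (∀ α, Order.succ α < μ →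
      let Q := C (Order.succ α) ⧸ (C α).submoduleOf (C (Order.succ α))
      Module.Free R Q ∨ ∃ M ∈ Φ, Nonempty (Q ≃ₗ[R] M))

/-!
The module is built inside the fixed rational vector space `V = I →₀ (ℕ →₀ ℚ)`, where `I` is the
well-order of type `κ.ord`. By recursion on `α : I` a submodule `block α` is adjoined, given by two
maps `π α : F → ℕ →₀ ℚ` and `f α : F → V` on the free module `F` of countable rank: it is the image
of `x ↦ f α x + single α (π α x)`, provided that `f α` takes values in the vectors supported below
`α` and maps the kernel of `π α` into the sum of the previous blocks; otherwise it is zero. This is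
the pushout of `ker (π α) → F` along the restriction of `f α`, realised inside `V`. By the condition
on the kernel, the elements of the sum of all blocks that are supported below `α` are exactly the
sum of the previous blocks (`mem_blockSum_of_mem_supported`). So the successive quotients are the
ranges of the `π α`, or zero.

A free-by-1 module is a quotient of `F` and embeds into `ℕ →₀ ℚ`
(`IsFreeByOne.exists_surjective_injective`), so it is the range of some `π`. There are at most
`κ ^ ℵ₀ = κ` pairs consisting of a member of `Φ` (or the free module of rank one) and a map
`F → V`, so all of them can be listed along `I`, each one at arbitrarily large indices
(`exists_forall_exists_ge_eq`). The sum `G` of all blocks then has the required properties.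

* Completeness: for `M = F / N` with `M ∈ Φ`, a map `N → G` extends to a map `h : F → V`, since `V`
  is divisible. As `κ` is regular and uncountable, `h` takes values in the vectors supported below
  some `α`; the pair `(M, h)` occurs at some `β ≥ α`, where the block provides an extension `F → G`
  (`exists_extension_of_frequently`). Since `F` is projective, `Ext¹(M, G) = 0`.
* Rank and nucleus: the free module of rank one is adjoined `κ` times. A generator of such a
  summand is divisible in `G` only by the units of `R`, because the later quotients are
  torsion-free.
* `n`-freeness: a nonzero submodule of finite rank has a largest coordinate `α` on which it does not
  vanish. Its projection there is a submodule of the range of `π α`, hence free, and the kernel of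
  the projection is free by induction on `α` (`free_of_rank_le_of_le_blockSum`).
-/

universe v

/-! ### Sums of blocks and their filtration by supports -/

section Filtration

variable {R F W : Type*} {I : Type*} [CommRing R] [AddCommGroup F] [Module R F]
  [AddCommGroup W] [Module R W] [LinearOrder I]

open Classical in
/-- The submodule adjoined at index `α`: the image of `x ↦ f α x + single α (π α x)` if
`f α` takes values in vectors supported below `α` and maps the kernel of `π α` into the sum of the
previous blocks, and `⊥` otherwise. -/
noncomputable def block [WellFoundedLT I] (π : I → F →ₗ[R] W) (f : I → F →ₗ[R] (I →₀ W)) (α : I) :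
    Submodule R (I →₀ W) :=
  if (∀ x, f α x ∈ Finsupp.supported W R (Set.Iio α)) ∧
      ∀ x, π α x = 0 → f α x ∈ ⨆ β : Set.Iio α, block π f β.1 then
    LinearMap.range (f α + Finsupp.lsingle α ∘ₗ π α)
  else ⊥
termination_by wellFounded_lt.wrap α
decreasing_by exact β.2

/-- The sum of the blocks with index in `s`. -/
noncomputable def blockSum [WellFoundedLT I] (π : I → F →ₗ[R] W) (f : I → F →ₗ[R] (I →₀ W))
    (s : Set I) : Submodule R (I →₀ W) :=
  ⨆ β : s, block π f β.1

/-- The condition under which the block at `α` is not set to `⊥`. -/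
def IsValid [WellFoundedLT I] (π : I → F →ₗ[R] W) (f : I → F →ₗ[R] (I →₀ W)) (α : I) : Prop :=
  (∀ x, f α x ∈ Finsupp.supported W R (Set.Iio α)) ∧
    ∀ x, π α x = 0 → f α x ∈ blockSum π f (Set.Iio α)

variable [WellFoundedLT I] {π : I → F →ₗ[R] W} {f : I → F →ₗ[R] (I →₀ W)}

lemma block_eq_range {α : I} (h : IsValid π f α) :
    block π f α = LinearMap.range (f α + Finsupp.lsingle α ∘ₗ π α) := by
  rw [block]; exact if_pos h

lemma block_eq_bot {α : I} (h : ¬ IsValid π f α) : block π f α = ⊥ := by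
  rw [block]; exact if_neg h

lemma block_le_blockSum {α : I} {s : Set I} (h : α ∈ s) : block π f α ≤ blockSum π f s :=
  le_iSup (fun β : s => block π f β.1) ⟨α, h⟩

lemma blockSum_mono {s t : Set I} (h : s ⊆ t) : blockSum π f s ≤ blockSum π f t :=
  iSup_le fun β => block_le_blockSum (h β.2)

lemma blockSum_Iic (α : I) :
    blockSum π f (Set.Iic α) = blockSum π f (Set.Iio α) ⊔ block π f α := by
  refine le_antisymm (iSup_le fun β => ?_) (sup_le (blockSum_mono Set.Iio_subset_Iic_self)
    (block_le_blockSum le_rfl))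
  rcases (show β.1 ≤ α from β.2).lt_or_eq with h | h
  · exact (block_le_blockSum (s := Set.Iio α) h).trans le_sup_left
  · rw [h]; exact le_sup_right

/-- An element of a sum of blocks lies in the sum up to one index. -/
lemma exists_mem_blockSum_Iic {s : Set I} {x : I →₀ W} (hx : x ∈ blockSum π f s) :
    x = 0 ∨ ∃ δ ∈ s, x ∈ blockSum π f (Set.Iic δ) := by
  rcases s.eq_empty_or_nonempty with rfl | hs
  · left; rwa [blockSum, iSup_of_empty] at hx
  · right
    have : Nonempty s := hs.to_subtype
    have hd : Directed (· ≤ ·) fun δ : s => blockSum π f (Set.Iic δ.1) :=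
      Monotone.directed_le fun a b h => blockSum_mono (Set.Iic_subset_Iic.2 h)
    have : x ∈ ⨆ δ : s, blockSum π f (Set.Iic δ.1) :=
      iSup_mono (fun β : s => block_le_blockSum (s := Set.Iic β.1) le_rfl) hx
    obtain ⟨δ, h⟩ := (Submodule.mem_iSup_of_directed _ hd).1 this
    exact ⟨δ.1, δ.2, h⟩

lemma block_le_supported (α : I) : block π f α ≤ Finsupp.supported W R (Set.Iic α) := by
  by_cases h : IsValid π f α
  · rw [block_eq_range h]
    rintro _ ⟨x, rfl⟩
    refine add_mem (Finsupp.supported_mono Set.Iio_subset_Iic_self (h.1 x)) ?_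
    exact Finsupp.single_mem_supported R _ (Set.self_mem_Iic)
  · rw [block_eq_bot h]; exact bot_le

lemma blockSum_le_supported {s : Set I} (hs : IsLowerSet s) :
    blockSum π f s ≤ Finsupp.supported W R s :=
  iSup_le fun β => (block_le_supported β.1).trans
    (Finsupp.supported_mono fun _ h => hs h β.2)

lemma apply_eq_zero_of_mem_blockSum_Iio {α β : I} {x : I →₀ W}
    (hx : x ∈ blockSum π f (Set.Iio α)) (h : α ≤ β) : x β = 0 :=
  Finsupp.notMem_support_iff.1 fun hb => not_lt.2 h
    ((Finsupp.mem_supported R x).1 (blockSum_le_supported (isLowerSet_Iio α) hx) hb)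

/-- The filtration of the sum of all blocks by supports coincides with the filtration by partial
sums: if the block at the top index `δ` contributes nothing to coordinate `δ`, then its
contribution is the value of `f δ` on an element of the kernel of `π δ`, which lies in the sum of
the previous blocks. -/
lemma mem_blockSum_of_mem_supported {s t : Set I} (hs : IsLowerSet s) {x : I →₀ W}
    (hx : x ∈ blockSum π f t) (hxs : x ∈ Finsupp.supported W R s) : x ∈ blockSum π f s := by
  have key : ∀ δ : I, x ∈ blockSum π f (Set.Iic δ) → x ∈ blockSum π f s := by
    intro δ
    induction δ using WellFoundedLT.induction with
    | ind δ ih =>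
    intro hδ
    by_cases hm : δ ∈ s
    · exact blockSum_mono (fun _ h => hs h hm) hδ
    · have hlow : x ∈ blockSum π f (Set.Iio δ) := by
        have hx0 : x δ = 0 := Finsupp.notMem_support_iff.1 fun hb =>
          hm ((Finsupp.mem_supported R x).1 hxs hb)
        rw [blockSum_Iic, Submodule.mem_sup] at hδ
        obtain ⟨y, hy, z, hz, rfl⟩ := hδ
        refine add_mem hy ?_
        by_cases hv : IsValid π f δ
        · rw [block_eq_range hv] at hz
          obtain ⟨w, rfl⟩ := hz
          have h1 : y δ = 0 := apply_eq_zero_of_mem_blockSum_Iio hy le_rfl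
          have h2 : f δ w δ = 0 := Finsupp.notMem_support_iff.1 fun hb =>
            lt_irrefl δ ((Finsupp.mem_supported R _).1 (hv.1 w) hb)
          have h3 : π δ w = 0 := by simpa [h1, h2] using hx0
          simpa [h3] using hv.2 w h3
        · rw [block_eq_bot hv, Submodule.mem_bot] at hz
          rw [hz]; exact zero_mem _
      rcases exists_mem_blockSum_Iic hlow with h0 | ⟨γ, hγ, h⟩
      · rw [h0]; exact zero_mem _
      · exact ih γ hγ h
  rcases exists_mem_blockSum_Iic hx with h0 | ⟨γ, -, h⟩
  · rw [h0]; exact zero_mem _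
  · exact key γ h

/-- The projection to coordinate `α` of the sum of the blocks up to `α`. -/
lemma map_lapply_blockSum_Iic (α : I) :
    (blockSum π f (Set.Iic α)).map (Finsupp.lapply α) =
      (block π f α).map (Finsupp.lapply α) := by
  rw [blockSum_Iic, Submodule.map_sup, sup_eq_right]
  rintro _ ⟨x, hx, rfl⟩
  have : x α = 0 := apply_eq_zero_of_mem_blockSum_Iio hx le_rfl
  simp [this]

lemma map_lapply_block {α : I} (h : IsValid π f α) :
    (block π f α).map (Finsupp.lapply α) = LinearMap.range (π α) := by
  rw [block_eq_range h, ← LinearMap.range_comp]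
  congr 1
  ext x
  have h2 : f α x α = 0 := Finsupp.notMem_support_iff.1 fun hb =>
    lt_irrefl α ((Finsupp.mem_supported R _).1 (h.1 x) hb)
  simp [h2]

end Filtration

/-! ### Submodules of finite rank -/

section Submodules

variable {R V W : Type*} [CommRing R] [AddCommGroup V] [Module R V] [AddCommGroup W] [Module R W]

/-- If `p` vanishes on `A` and only on `A` within `B`, then `B / A` is the image of `B`. -/
lemma nonempty_quotient_submoduleOf_equiv_map {A B : Submodule R V}
    (p : V →ₗ[R] W) (h : ∀ x ∈ B, p x = 0 ↔ x ∈ A) :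
    Nonempty ((B ⧸ A.submoduleOf B) ≃ₗ[R] B.map p) := by
  have hker : A.submoduleOf B = LinearMap.ker (p ∘ₗ B.subtype) := by
    ext x
    exact (h x.1 x.2).symm
  have hrange : LinearMap.range (p ∘ₗ B.subtype) = B.map p := by
    rw [LinearMap.range_comp, Submodule.range_subtype]
  exact ⟨(Submodule.quotEquivOfEq _ _ hker).trans
    ((p ∘ₗ B.subtype).quotKerEquivRange.trans (LinearEquiv.ofEq _ _ hrange))⟩

/-- An extension of a free module by a free module is free. -/
lemma free_of_free_inf_ker_of_free_map {F : Submodule R V} (p : V →ₗ[R] W)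
    (hker : Module.Free R ↥(F ⊓ LinearMap.ker p)) (hmap : Module.Free R (F.map p)) :
    Module.Free R F := by
  let q : F →ₗ[R] F.map p := p.submoduleMap F
  have hq : Function.Surjective q := p.submoduleMap_surjective F
  let i : ↥(F ⊓ LinearMap.ker p) →ₗ[R] F := Submodule.inclusion inf_le_left
  have hi : Function.Injective i := Submodule.inclusion_injective _
  have hex : Function.Exact i q := by
    intro x
    constructor
    · intro hx
      exact ⟨⟨x.1, x.2, congrArg Subtype.val hx⟩, rfl⟩
    · rintro ⟨y, rfl⟩
      exact Subtype.ext y.2.2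
  obtain ⟨l, hl⟩ := Module.projective_lifting_property q LinearMap.id hq
  obtain ⟨e, -⟩ := hex.splitSurjectiveEquiv hi ⟨l, hl⟩
  exact Module.Free.of_equiv e.symm

/-- A submodule of finite rank is torsion modulo the span of a finite subset. -/
lemma exists_finset_torsion_mod_span [IsDomain R] (F : Submodule R V)
    (hF : Module.rank R F < ℵ₀) :
    ∃ s : Finset V, ↑s ⊆ (F : Set V) ∧
      ∀ x ∈ F, ∃ a : R, a ≠ 0 ∧ a • x ∈ Submodule.span R (s : Set V) := by
  obtain ⟨s, hs, hli⟩ := exists_set_linearIndependent_of_isDomain R F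
  have hfin : s.Finite := by
    rw [← Cardinal.lt_aleph0_iff_set_finite, hs]; exact hF
  have hrank : Module.rank R (Submodule.span R s) = Module.rank R F := by
    rw [← hs]; exact rank_span_set hli
  have h0 : Module.rank R (F ⧸ Submodule.span R s) = 0 := by
    have := rank_quotient_add_rank_of_isDomain (Submodule.span R s)
    rw [hrank] at this
    nth_rewrite 2 [← zero_add (Module.rank R F)] at this
    exact Cardinal.eq_of_add_eq_add_right this hF
  classical
  refine ⟨hfin.toFinset.image Subtype.val, ?_, fun x hx => ?_⟩
  · intro x hx
    simp only [Finset.coe_image, Set.Finite.coe_toFinset] at hx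
    obtain ⟨y, -, rfl⟩ := hx
    exact y.2
  · obtain ⟨a, ha, h⟩ := rank_eq_zero_iff.1 h0 (Submodule.Quotient.mk ⟨x, hx⟩)
    refine ⟨a, ha, ?_⟩
    rw [← Submodule.Quotient.mk_smul, Submodule.Quotient.mk_eq_zero] at h
    simp only [Finset.coe_image, Set.Finite.coe_toFinset]
    have := Submodule.mem_map_of_mem (f := F.subtype) h
    rwa [Submodule.map_span] at this

end Submodules

section FiniteRank

variable {R F W : Type*} {I : Type*} [CommRing R] [AddCommGroup F] [Module R F]
  [AddCommGroup W] [Module R W] [LinearOrder I] [WellFoundedLT I]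
  {π : I → F →ₗ[R] W} {f : I → F →ₗ[R] (I →₀ W)}

omit [WellFoundedLT I] in
/-- A nonzero submodule of finite rank has a largest coordinate on which it does not vanish. -/
lemma exists_maximal_coordinate [IsDomain R] [Module.IsTorsionFree R W]
    (N : Submodule R (I →₀ W)) (hN : Module.rank R N < ℵ₀) (h0 : N ≠ ⊥) :
    ∃ α, N ≤ Finsupp.supported W R (Set.Iic α) ∧ ∃ x ∈ N, x α ≠ 0 := by
  obtain ⟨s, hsN, hs⟩ := exists_finset_torsion_mod_span N hN
  classical
  let t : Finset I := s.biUnion Finsupp.support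
  have ht : N ≤ Finsupp.supported W R (t : Set I) := by
    intro x hx
    obtain ⟨a, ha, h⟩ := hs x hx
    have hspan : Submodule.span R (s : Set (I →₀ W)) ≤ Finsupp.supported W R (t : Set I) := by
      rw [Submodule.span_le]
      intro y hy
      exact (Finsupp.mem_supported R y).2 (by
        exact_mod_cast Finset.subset_biUnion_of_mem Finsupp.support hy)
    rw [Finsupp.mem_supported]
    intro i hi
    refine (Finsupp.mem_supported R _).1 (hspan h) ?_
    rw [Finset.mem_coe, Finsupp.mem_support_iff] at hi ⊢
    exact smul_ne_zero ha hi
  have htne : t.Nonempty := by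
    obtain ⟨x, hx, hx0⟩ := Submodule.exists_mem_ne_zero_of_ne_bot h0
    obtain ⟨i, hi⟩ := Finsupp.support_nonempty_iff.2 hx0
    exact ⟨i, (Finsupp.mem_supported R x).1 (ht hx) hi⟩
  refine ⟨t.max' htne, ht.trans (Finsupp.supported_mono fun i hi => t.le_max' i hi), ?_⟩
  obtain ⟨x, hx, hxt⟩ := Finset.mem_biUnion.1 (t.max'_mem htne)
  exact ⟨x, hsN hx, Finsupp.mem_support_iff.1 hxt⟩

/-- If the ranges of all `π α` are `n`-free, then so is the sum of all blocks. -/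
lemma free_of_rank_le_of_le_blockSum [IsDomain R] [Module.IsTorsionFree R W] {n : ℕ}
    (hπ : ∀ α, IsNFree R n (LinearMap.range (π α)))
    (N : Submodule R (I →₀ W)) (hN : N ≤ blockSum π f Set.univ) (hn : Module.rank R N ≤ n) :
    Module.Free R N := by
  have key : ∀ α : I, ∀ N : Submodule R (I →₀ W), N ≤ blockSum π f Set.univ →
      Module.rank R N ≤ n → N ≤ Finsupp.supported W R (Set.Iic α) → Module.Free R N := by
    intro α
    induction α using WellFoundedLT.induction with
    | ind α ih =>
    intro N hN hn hsupp
    have hmap : Module.Free R (N.map (Finsupp.lapply α)) := by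
      have hle : N.map (Finsupp.lapply α) ≤ (block π f α).map (Finsupp.lapply α) := by
        rw [← map_lapply_blockSum_Iic]
        exact Submodule.map_mono fun x hx =>
          mem_blockSum_of_mem_supported (isLowerSet_Iic α) (hN hx) (hsupp hx)
      by_cases hv : IsValid π f α
      · rw [map_lapply_block hv] at hle
        have e := Submodule.submoduleOfEquivOfLe hle
        have : Module.Free R ((N.map (Finsupp.lapply α)).submoduleOf (LinearMap.range (π α))) := by
          apply hπ α
          rw [e.rank_eq]
          have := lift_rank_map_le (Finsupp.lapply α : (I →₀ W) →ₗ[R] W) N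
          have h2 := this.trans (Cardinal.lift_le.2 hn)
          simpa using h2
        exact Module.Free.of_equiv e
      · rw [block_eq_bot hv, Submodule.map_bot, le_bot_iff] at hle
        rw [hle]
        infer_instance
    have hker : Module.Free R ↥(N ⊓ LinearMap.ker (Finsupp.lapply α : (I →₀ W) →ₗ[R] W)) := by
      set K := N ⊓ LinearMap.ker (Finsupp.lapply α : (I →₀ W) →ₗ[R] W) with hK
      by_cases hbot : K = ⊥
      · rw [hbot]; infer_instance
      have hKn : Module.rank R K ≤ n := (Submodule.rank_mono inf_le_left).trans hn
      obtain ⟨β, hβ, x, hx, hxβ⟩ :=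
        exists_maximal_coordinate K (hKn.trans_lt (Cardinal.natCast_lt_aleph0)) hbot
      have hβα : β < α := by
        refine lt_of_le_of_ne ((Finsupp.mem_supported R x).1 (hsupp hx.1)
          (Finsupp.mem_support_iff.2 hxβ)) ?_
        rintro rfl
        exact hxβ hx.2
      exact ih β hβα K (inf_le_left.trans hN) hKn hβ
    exact free_of_free_inf_ker_of_free_map _ hker hmap
  by_cases hbot : N = ⊥
  · rw [hbot]; infer_instance
  obtain ⟨β, hβ, -⟩ := exists_maximal_coordinate N (hn.trans_lt Cardinal.natCast_lt_aleph0) hbot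
  exact key β N hN hn hβ

end FiniteRank

/-! ### Subrings of the rationals -/

section SubringRat

variable (R : Subring ℚ)

/-- By Bézout, `R` contains the inverse of the reduced denominator of each of its elements. -/
lemma inv_den_mem {q : ℚ} (hq : q ∈ R) : ((q.den : ℚ))⁻¹ ∈ R := by
  have hb := Rat.isCoprime_num_den q
  obtain ⟨a, b, hab⟩ := hb
  have hden : (q.den : ℚ) ≠ 0 := by exact_mod_cast q.den_nz
  have h : ((q.den : ℚ))⁻¹ = a * q + b := by
    have hab' : (a : ℚ) * q.num + b * q.den = 1 := by exact_mod_cast hab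
    have hq' : q * q.den = q.num := Rat.mul_den_eq_num q
    field_simp
    rw [← hab', ← hq']; ring
  rw [h]
  exact add_mem (mul_mem (intCast_mem R a) hq) (intCast_mem R b)

/-- Every ideal is generated by its intersection with `ℤ`, since `R` contains the inverse of the
reduced denominator of each of its elements. -/
instance isPrincipalIdealRing_subring_rat : IsPrincipalIdealRing R := by
  refine ⟨fun J => ?_⟩
  obtain ⟨d, hd⟩ := (inferInstance : (J.comap (Int.castRingHom R)).IsPrincipal)
  have hd' : ∀ z : ℤ, (z : R) ∈ J ↔ d ∣ z := by
    intro z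
    rw [← Ideal.mem_span_singleton, ← Ideal.submodule_span_eq, ← hd, Ideal.mem_comap]
    simp
  refine ⟨(d : R), le_antisymm ?_ ?_⟩
  · intro x hx
    have hden : ((x : ℚ).den : ℚ) ≠ 0 := by exact_mod_cast (x : ℚ).den_nz
    have hnum : (((x : ℚ).num : ℤ) : R) = ((x : ℚ).den : R) * x := by
      apply Subtype.ext
      push_cast
      rw [mul_comm]; exact (Rat.mul_den_eq_num (x : ℚ)).symm
    have hmem : (((x : ℚ).num : ℤ) : R) ∈ J := by
      rw [hnum]; exact J.mul_mem_left _ hx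
    obtain ⟨c, hc⟩ := (hd' _).1 hmem
    rw [Ideal.submodule_span_eq, Ideal.mem_span_singleton]
    refine ⟨(c : R) * ⟨_, inv_den_mem R x.2⟩, ?_⟩
    apply Subtype.ext
    push_cast
    rw [← mul_assoc, ← Int.cast_mul, ← hc]
    rw [eq_mul_inv_iff_mul_eq₀ hden]
    exact Rat.mul_den_eq_num (x : ℚ)
  · rw [Submodule.span_le, Set.singleton_subset_iff]
    exact (hd' d).2 dvd_rfl

/-- Rational vector spaces are injective over `R`: ideals are principal and `V` is divisible. -/
lemma baer_of_rat_module (V : Type*) [AddCommGroup V] [Module ℚ V] [Module R V]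
    [IsScalarTower R ℚ V] : Module.Baer R V := by
  intro J g
  obtain ⟨d, hd⟩ := (inferInstance : J.IsPrincipal)
  have hdJ : d ∈ J := by rw [hd]; exact Submodule.mem_span_singleton_self d
  by_cases h0 : d = 0
  · refine ⟨0, fun x hx => ?_⟩
    have hx0 : x = 0 := by
      rw [hd, h0] at hx
      simpa using hx
    subst hx0
    have : (⟨0, hx⟩ : J) = 0 := rfl
    rw [this, map_zero, map_zero]
  · refine ⟨LinearMap.toSpanSingleton R V ((d : ℚ)⁻¹ • g ⟨d, hdJ⟩), fun x hx => ?_⟩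
    have hx' := hx
    rw [hd, Submodule.mem_span_singleton] at hx'
    obtain ⟨r, rfl⟩ := hx'
    have : (⟨r • d, hx⟩ : J) = r • ⟨d, hdJ⟩ := rfl
    rw [LinearMap.toSpanSingleton_apply, smul_assoc, this, map_smul]
    congr 1
    have hd0 : (d : ℚ) ≠ 0 := fun h => h0 (Subtype.ext h)
    rw [← smul_assoc, Subring.smul_def, smul_eq_mul, mul_inv_cancel₀ hd0, one_smul]

/-- If some `e` is divisible only by natural numbers that are invertible in `R`, then no larger
subring of `ℚ` acts on `V`. -/
lemma isNucleus_of_divisors {V : Type*} [AddCommGroup V] [Module R V] (e : V)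
    (he : ∀ (m : ℕ) (x : V), m ≠ 0 → m • x = e → ((m : ℚ))⁻¹ ∈ R) : IsNucleus R V := by
  refine ⟨⟨inferInstance⟩, ?_⟩
  rintro S ⟨hS⟩ q hq
  have h := inv_den_mem S hq
  have hden : (q.den : ℚ) ≠ 0 := by exact_mod_cast q.den_nz
  have hm := he q.den (hS.smul ⟨_, h⟩ e) q.den_nz (by
    have h1 : (q.den : S) * ⟨_, h⟩ = 1 := Subtype.ext (mul_inv_cancel₀ hden)
    have := mul_smul (q.den : S) ⟨_, h⟩ e
    rw [h1, one_smul] at this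
    rw [← Nat.cast_smul_eq_nsmul S]
    exact this.symm)
  rw [← Rat.num_div_den q, div_eq_mul_inv]
  exact mul_mem (intCast_mem R _) hm

end SubringRat

/-! ### Vanishing of Ext -/

section Ext

/-- `Ext¹(M, L) = 0` if maps to `L` extend from the kernel of some surjection `F → M` with `F`
projective to all of `F`. -/
lemma subsingleton_ext_one_of_extension {R : Type*} [Ring R] [Small.{u} R] {F : Type u}
    [AddCommGroup F] [Module R F] [Module.Projective R F] (M : ModuleCat.{u} R) (L : Type u)
    [AddCommGroup L] [Module R L] (q : F →ₗ[R] M) (hq : Function.Surjective q)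
    (h : ∀ g : LinearMap.ker q →ₗ[R] L, ∃ g' : F →ₗ[R] L, g' ∘ₗ (LinearMap.ker q).subtype = g) :
    Subsingleton (Abelian.Ext M (ModuleCat.of R L) 1) := by
  refine subsingleton_of_forall_eq 0 fun x => ?_
  have hS := LinearMap.shortExact_shortComplexKer hq
  have : Projective (ModuleCat.of R F) := (IsProjective.iff_projective F).1 inferInstance
  obtain ⟨y, hy⟩ := Abelian.Ext.contravariant_sequence_exact₃ hS (ModuleCat.of R L) (n₁ := 1) x
    (Abelian.Ext.eq_zero_of_projective _) (n₀ := 0) (by norm_num)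
  obtain ⟨z, rfl⟩ : ∃ z, Abelian.Ext.mk₀ z = y :=
    ⟨Abelian.Ext.addEquiv₀ y, Abelian.Ext.mk₀_addEquiv₀_apply y⟩
  obtain ⟨g', hg'⟩ := h z.hom
  have hz : z = q.shortComplexKer.f ≫ ModuleCat.ofHom g' := by
    ext w
    exact (DFunLike.congr_fun hg' w).symm
  rw [← hy, hz, ← Abelian.Ext.mk₀_comp_mk₀, hS.extClass_comp_assoc]

end Ext

/-! ### Embedding free-by-1 modules into rational vector spaces -/

section FreeByOne

/-- Modulo the relators, every element is a combination of the `x i` and of a single `y m`, for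
all large `m`. -/
lemma exists_sub_mem_span_freeByOneRelator {R : Type*} [CommRing R] {n : ℕ}
    (p : ℕ → R) (k : Fin n → ℕ → R) (v : (Fin n ⊕ ℕ) →₀ R) :
    ∃ m₀, ∀ m ≥ m₀, ∃ (a : Fin n → R) (c : R),
      v - (∑ i, Finsupp.single (Sum.inl i) (a i) + Finsupp.single (Sum.inr m) c) ∈
        Submodule.span R (Set.range (freeByOneRelator p k)) := by
  induction v using Finsupp.induction_linear with
  | zero => exact ⟨0, fun m _ => ⟨0, 0, by simp⟩⟩
  | add v w hv hw =>
    obtain ⟨m₁, h₁⟩ := hv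
    obtain ⟨m₂, h₂⟩ := hw
    refine ⟨max m₁ m₂, fun m hm => ?_⟩
    obtain ⟨a, c, h⟩ := h₁ m (le_of_max_le_left hm)
    obtain ⟨b, d, h'⟩ := h₂ m (le_of_max_le_right hm)
    refine ⟨a + b, c + d, ?_⟩
    convert add_mem h h' using 1
    simp only [Pi.add_apply, Finsupp.single_add, Finset.sum_add_distrib]
    abel
  | single s r =>
    rcases s with i | j
    · refine ⟨0, fun m _ => ⟨Pi.single i r, 0, ?_⟩⟩
      have : ∑ l, Finsupp.single (Sum.inl l : Fin n ⊕ ℕ) ((Pi.single i r : Fin n → R) l) =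
          Finsupp.single (Sum.inl i) r := by
        rw [Finset.sum_eq_single i]
        · simp
        · intro b _ hb; simp [hb]
        · simp
      simp [this]
    · refine ⟨j, fun m hm => ?_⟩
      induction m, hm using Nat.le_induction with
      | base => exact ⟨0, r, by simp⟩
      | succ m _ ih =>
        obtain ⟨a, c, h⟩ := ih
        refine ⟨fun i => a i - c * k i m, c * p m, ?_⟩
        have hr : c • freeByOneRelator p k m ∈
            Submodule.span R (Set.range (freeByOneRelator p k)) :=
          Submodule.smul_mem _ _ (Submodule.subset_span ⟨m, rfl⟩)
        convert sub_mem h hr using 1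
        simp only [freeByOneRelator, smul_sub, Finset.smul_sum, Finsupp.smul_single, smul_eq_mul,
          mul_one, Finsupp.single_sub, Finset.sum_sub_distrib]
        abel

/-- The vectors `y m` solving the relations over `ℚ`, when `x i` is the basis vector `i + 1` and
`y 0` is the basis vector `0`. -/
noncomputable def ratSolution {n : ℕ} (p : ℕ → ℚ) (k : Fin n → ℕ → ℚ) : ℕ → (ℕ →₀ ℚ)
  | 0 => Finsupp.single 0 1
  | m + 1 => (p m)⁻¹ • (ratSolution p k m + ∑ i : Fin n, Finsupp.single (i.1 + 1) (k i m))

lemma ratSolution_apply_zero_ne_zero {n : ℕ} {p : ℕ → ℚ} (k : Fin n → ℕ → ℚ)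
    (hp : ∀ m, p m ≠ 0) (m : ℕ) : ratSolution p k m 0 ≠ 0 := by
  induction m with
  | zero => simp [ratSolution]
  | succ m ih => simp [ratSolution, hp m, ih]

/-- A free-by-1 module over a subring of `ℚ` is countably generated and embeds into a
`ℚ`-vector space of countable dimension. -/
lemma IsFreeByOne.exists_surjective_injective {R : Subring ℚ} {n : ℕ} {M : Type*}
    [AddCommGroup M] [Module R M] (h : IsFreeByOne R n M) :
    ∃ (q : (ULift.{v} ℕ →₀ R) →ₗ[R] M) (j : M →ₗ[R] (ℕ →₀ ℚ)),
      Function.Surjective q ∧ Function.Injective j := by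
  obtain ⟨⟨p, k, hp, ⟨e⟩⟩, -⟩ := h
  set S := Submodule.span R (Set.range (freeByOneRelator p k)) with hS
  let t : ℕ → (ℕ →₀ ℚ) := ratSolution (fun m => (p m : ℚ)) (fun i m => (k i m : ℚ))
  have hp' : ∀ m, (p m : ℚ) ≠ 0 := fun m h => hp m (Subtype.ext h)
  have ht0 : ∀ m, t m 0 ≠ 0 := ratSolution_apply_zero_ne_zero _ hp'
  let E : ((Fin n ⊕ ℕ) →₀ R) →ₗ[R] (ℕ →₀ ℚ) :=
    Finsupp.linearCombination R (Sum.elim (fun i => Finsupp.single (i.1 + 1) 1) t)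
  have hsmul : ∀ (r : R) (l : ℕ), r • Finsupp.single l (1 : ℚ) = Finsupp.single l (r : ℚ) := by
    intro r l
    rw [Finsupp.smul_single, Subring.smul_def, smul_eq_mul, mul_one]
  have hSE : S ≤ LinearMap.ker E := by
    rw [hS, Submodule.span_le]
    rintro _ ⟨m, rfl⟩
    have hm : t (m + 1) = (p m : ℚ)⁻¹ •
      (t m + ∑ i : Fin n, Finsupp.single (i.1 + 1) (k i m : ℚ)) := rfl
    have hm' : p m • t (m + 1) = t m + ∑ i : Fin n, Finsupp.single (i.1 + 1) (k i m : ℚ) := by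
      rw [hm, Subring.smul_def, smul_smul, mul_inv_cancel₀ (hp' m), one_smul]
    simp only [SetLike.mem_coe, LinearMap.mem_ker, freeByOneRelator, map_sub, map_sum, E,
      Finsupp.linearCombination_single, Sum.elim_inl, Sum.elim_inr, one_smul, hsmul, hm']
    abel
  have hES : LinearMap.ker E ≤ S := by
    intro v hv
    obtain ⟨m, hm⟩ := exists_sub_mem_span_freeByOneRelator p k v
    obtain ⟨a, c, h⟩ := hm m le_rfl
    have hE := hSE h
    rw [LinearMap.mem_ker, map_sub, LinearMap.mem_ker.1 hv, zero_sub, neg_eq_zero] at hE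
    simp only [map_add, map_sum, E, Finsupp.linearCombination_single, Sum.elim_inl,
      Sum.elim_inr, hsmul] at hE
    have hc : c = 0 := by
      have h0 := DFunLike.congr_fun hE 0
      simp only [Finsupp.add_apply, Finsupp.finsetSum_apply, Finsupp.smul_apply,
        Finsupp.zero_apply] at h0
      have hz : ∀ i : Fin n, Finsupp.single (i.1 + 1) (a i : ℚ) 0 = 0 := fun i => by simp
      simp only [hz, Finset.sum_const_zero, zero_add, smul_eq_zero, ht0, or_false] at h0
      exact h0
    have ha : ∀ i, a i = 0 := by
      intro i
      rw [hc, zero_smul, add_zero] at hE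
      have h0 := DFunLike.congr_fun hE (i.1 + 1)
      rw [Finsupp.finsetSum_apply, Finset.sum_eq_single i] at h0
      · simpa using h0
      · intro b _ hb
        rw [Finsupp.single_apply, if_neg]
        intro hbi
        exact hb (Fin.ext (by omega))
      · simp
    simpa [hc, ha] using h
  -- enumerate the generators by `ℕ`
  let g : ULift.{v} ℕ → Fin n ⊕ ℕ :=
    fun m => if hm : m.down < n then Sum.inl ⟨m.down, hm⟩ else Sum.inr (m.down - n)
  have hg : Function.Surjective g := by
    rintro (i | m)
    · exact ⟨⟨i⟩, by simp [g]⟩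
    · exact ⟨⟨m + n⟩, by simp [g]⟩
  refine ⟨e.symm.toLinearMap ∘ₗ S.mkQ ∘ₗ Finsupp.lmapDomain R R g,
    S.liftQ E hSE ∘ₗ e.toLinearMap, ?_, ?_⟩
  · exact e.symm.surjective.comp (S.mkQ_surjective.comp (Finsupp.mapDomain_surjective hg))
  · exact (LinearMap.ker_eq_bot.1 (Submodule.ker_liftQ_eq_bot S E hSE hES)).comp e.injective

end FreeByOne

/-! ### Cardinal arithmetic and bookkeeping -/

section Cardinals

lemma aleph0_lt_of_power_aleph0_eq {κ : Cardinal.{u}} (hκ : κ.IsRegular) (hpow : κ ^ ℵ₀ = κ) :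
    ℵ₀ < κ :=
  hκ.aleph0_le.lt_of_ne' fun h => by
    rw [h, Cardinal.aleph0_power_aleph0] at hpow
    exact Cardinal.aleph0_lt_continuum.ne' hpow

lemma exists_forall_lt_of_countable {κ : Cardinal.{u}} (hκ : κ.IsRegular) (h : ℵ₀ < κ)
    {s : Set κ.ord.ToType} (hs : s.Countable) : ∃ α, ∀ x ∈ s, x < α := by
  rw [← not_isCofinal_iff]
  intro hc
  have := Order.cof_le hc
  rw [Ordinal.cof_toType, hκ.cof_ord] at this
  exact absurd (this.trans hs.le_aleph0) h.not_ge

/-- A set of at most `κ` elements can be listed along `κ` with each element occurring at arbitrarily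
large indices: list it along a bijection `κ ≃ κ × κ`, so that each element occurs `κ` times. -/
lemma exists_forall_exists_ge_eq {κ : Cardinal.{u}} (hκ : ℵ₀ ≤ κ) {T : Type v} [Nonempty T]
    (hT : Cardinal.lift.{u} #T ≤ Cardinal.lift.{v} κ) :
    ∃ τ : κ.ord.ToType → T, ∀ t α, ∃ β, α ≤ β ∧ τ β = t := by
  have hI : #κ.ord.ToType = κ := Cardinal.mk_ord_toType κ
  obtain ⟨e⟩ : Nonempty (κ.ord.ToType ≃ κ.ord.ToType × κ.ord.ToType) := by
    rw [← Cardinal.eq, ← Cardinal.mul_def, hI, Cardinal.mul_eq_self hκ]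
  obtain ⟨i⟩ : Nonempty (T ↪ κ.ord.ToType) := by
    rw [← Cardinal.lift_mk_le', hI]; exact hT
  refine ⟨fun β => Function.invFun i (e β).2, fun t α => ?_⟩
  by_contra! hcon
  have hlt : ∀ x, e.symm (x, i t) < α := fun x => by
    by_contra hx
    refine hcon _ (not_lt.1 hx) ?_
    simpa using Function.leftInverse_invFun i.injective t
  have hle : #κ.ord.ToType ≤ #(Set.Iio α) :=
    Cardinal.mk_le_of_injective (f := fun x => (⟨e.symm (x, i t), hlt x⟩ : Set.Iio α))
      fun x y hxy => by
        have := e.symm.injective (Subtype.ext_iff.1 hxy)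
        exact (Prod.ext_iff.1 this).1
  rw [hI] at hle
  exact absurd (Cardinal.mk_Iio_lt α (by simp)) (by rw [hI]; exact hle.not_gt)

lemma mk_finsupp_countable {κ : Cardinal.{u}} (hκ : ℵ₀ ≤ κ) :
    #(κ.ord.ToType →₀ ℕ →₀ ℚ) = κ := by
  have hI : #κ.ord.ToType = κ := Cardinal.mk_ord_toType κ
  have : Infinite κ.ord.ToType := by rw [Cardinal.infinite_iff, hI]; exact hκ
  rw [Cardinal.mk_finsupp_lift_of_infinite, hI]
  have h1 : #(ℕ →₀ ℚ) ≤ ℵ₀ := Cardinal.mk_le_aleph0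
  have h2 : Cardinal.lift.{u} #(ℕ →₀ ℚ) ≤ ℵ₀ := by simp
  simpa using h2.trans hκ

lemma lift_mk_option_prod_le {κ : Cardinal.{u}} (hκ : ℵ₀ ≤ κ) (hpow : κ ^ ℵ₀ = κ)
    {A : Type v} {V : Type u} (hA : Cardinal.lift.{u} #A < Cardinal.lift.{v} κ) (hV : #V = κ) :
    Cardinal.lift.{u} #(Option A × (ℕ → V)) ≤ Cardinal.lift.{v} κ := by
  have hκ' : ℵ₀ ≤ Cardinal.lift.{v} κ := by simpa using hκ
  have hfun : #(ℕ → V) = κ := by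
    simp [hV, hpow]
  rw [Cardinal.mk_prod, Cardinal.mk_option, hfun, Cardinal.lift_mul, Cardinal.lift_lift,
    Cardinal.lift_lift, Cardinal.lift_add, Cardinal.lift_one]
  have h1 : Cardinal.lift.{u} #A + 1 ≤ Cardinal.lift.{v} κ :=
    Cardinal.add_le_of_le hκ' hA.le (Cardinal.one_le_aleph0.trans hκ')
  have h3 : Cardinal.lift.{u} (#A + 1) * Cardinal.lift.{v} κ ≤ Cardinal.lift.{v} κ :=
    Cardinal.mul_le_of_le hκ' (by simpa using h1) le_rfl
  have h4 : Cardinal.lift.{max v u} κ = Cardinal.lift.{v} κ :=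
    congrFun Cardinal.lift_umax.{u, v} κ
  simpa [h4] using h3

end Cardinals

/-! ### Transport of `n`-freeness -/

section NFree

lemma IsNFree.of_equiv {R : Type*} [CommRing R] {n : ℕ} {M : Type u} {N : Type v}
    [AddCommGroup M] [Module R M] [AddCommGroup N] [Module R N] (e : M ≃ₗ[R] N)
    (h : IsNFree R n M) : IsNFree R n N := by
  intro F hF
  have e' := e.symm.submoduleMap F
  have hr := e'.lift_rank_eq
  have : Module.Free R (F.map e.symm.toLinearMap) := by
    apply h
    rw [← Cardinal.lift_le.{v}]
    refine (le_of_eq hr.symm).trans ((Cardinal.lift_le.2 hF).trans ?_)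
    simp
  exact Module.Free.of_equiv e'.symm

lemma nonempty_range_comp_equiv {R : Type*} [CommRing R] {F M W : Type*} [AddCommGroup F]
    [Module R F] [AddCommGroup M] [Module R M] [AddCommGroup W] [Module R W] (q : F →ₗ[R] M)
    (j : M →ₗ[R] W) (hq : Function.Surjective q) (hj : Function.Injective j) :
    Nonempty (LinearMap.range (j ∘ₗ q) ≃ₗ[R] M) := by
  have : LinearMap.range (j ∘ₗ q) = LinearMap.range j := by
    rw [LinearMap.range_comp, LinearMap.range_eq_top.2 hq, Submodule.map_top]
  exact ⟨(LinearEquiv.ofEq _ _ this).trans (LinearEquiv.ofInjective j hj).symm⟩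

lemma isNFree_self {R : Type*} [CommRing R] [IsDomain R] [IsPrincipalIdealRing R] (n : ℕ) :
    IsNFree R n R := fun N _ => by
  obtain ⟨m, ⟨b⟩⟩ := Submodule.nonempty_basis_of_pid (Module.Basis.singleton Unit R) N
  exact Module.Free.of_basis b

end NFree

/-! ### The chain of partial sums, indexed by ordinals -/

section Chain

variable {R : Type*} [CommRing R] {F W : Type*} [AddCommGroup F] [Module R F]
  [AddCommGroup W] [Module R W] {o : Ordinal.{u}} {π : o.ToType → F →ₗ[R] W}
  {f : o.ToType → F →ₗ[R] (o.ToType →₀ W)}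

variable (π f) in
/-- The sum of the blocks of index `< α`, for an ordinal `α`, as a submodule of the sum of all
blocks. -/
noncomputable def blockChain (α : Ordinal.{u}) : Submodule R (blockSum π f Set.univ) :=
  (blockSum π f ((fun i : o.ToType => (i.toOrd : Ordinal)) ⁻¹' Set.Iio α)).submoduleOf
    (blockSum π f Set.univ)

lemma monotone_blockChain : Monotone (blockChain π f) := fun _ _ h =>
  Submodule.comap_mono (blockSum_mono (Set.preimage_mono (Set.Iio_subset_Iio h)))

lemma blockChain_zero : blockChain π f 0 = ⊥ := by
  rw [eq_bot_iff]
  intro x hx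
  rcases exists_mem_blockSum_Iic hx with h | ⟨i, hi, -⟩
  · exact Subtype.ext h
  · exact absurd (Set.mem_Iio.1 (Set.mem_preimage.1 hi)) not_lt_zero

lemma blockChain_eq_iSup {δ : Ordinal.{u}} (hδ : Order.IsSuccLimit δ) :
    blockChain π f δ = ⨆ α : Set.Iio δ, blockChain π f α := by
  refine le_antisymm (fun x hx => ?_) (iSup_le fun α => monotone_blockChain (le_of_lt α.2))
  rcases exists_mem_blockSum_Iic hx with h | ⟨i, hi, h⟩
  · rw [show x = 0 from Subtype.ext h]; exact zero_mem _
  · have hi' : (i.toOrd : Ordinal) < δ := hi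
    refine Submodule.mem_iSup_of_mem (⟨_, hδ.succ_lt hi'⟩ : Set.Iio δ) ?_
    refine blockSum_mono (fun j hj => ?_) h
    have hji : (j.toOrd : Ordinal) ≤ (i.toOrd : Ordinal) :=
      Ordinal.ToType.mk.symm.monotone (Set.mem_Iic.1 hj)
    exact Order.lt_succ_of_le hji

lemma blockChain_eq_top : blockChain π f o = ⊤ := by
  rw [blockChain, Submodule.submoduleOf, Submodule.comap_subtype_eq_top]
  exact blockSum_mono fun i _ => i.toOrd.2

lemma preimage_toOrd_Iio (i : o.ToType) :
    (fun j : o.ToType => (j.toOrd : Ordinal)) ⁻¹' Set.Iio (i.toOrd : Ordinal) = Set.Iio i := by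
  ext j
  rw [Set.mem_preimage, Set.mem_Iio, Set.mem_Iio, Subtype.coe_lt_coe]
  exact Ordinal.ToType.mk.symm.lt_iff_lt

lemma preimage_toOrd_Iio_succ (i : o.ToType) :
    (fun j : o.ToType => (j.toOrd : Ordinal)) ⁻¹' Set.Iio (Order.succ (i.toOrd : Ordinal)) =
      Set.Iic i := by
  ext j
  rw [Set.mem_preimage, Set.mem_Iio, Set.mem_Iic, Order.lt_succ_iff, Subtype.coe_le_coe]
  exact Ordinal.ToType.mk.symm.le_iff_le

/-- Within the next member of the chain, each member is the kernel of a coordinate map. -/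
lemma lapply_eq_zero_iff_mem_blockChain (i : o.ToType) {x : blockSum π f Set.univ}
    (hx : x ∈ blockChain π f (Order.succ (i.toOrd : Ordinal))) :
    (Finsupp.lapply i ∘ₗ (blockSum π f Set.univ).subtype) x = 0 ↔
      x ∈ blockChain π f (i.toOrd : Ordinal) := by
  rw [blockChain, preimage_toOrd_Iio_succ] at hx
  rw [blockChain, preimage_toOrd_Iio]
  refine ⟨fun h => ?_, fun h => apply_eq_zero_of_mem_blockSum_Iio h le_rfl⟩
  refine mem_blockSum_of_mem_supported (isLowerSet_Iio i) hx ?_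
  rw [Finsupp.mem_supported]
  intro j hj
  have hji : j ≤ i :=
    (Finsupp.mem_supported R _).1 (blockSum_le_supported (isLowerSet_Iic i) hx) hj
  refine lt_of_le_of_ne hji ?_
  rintro rfl
  exact Finsupp.mem_support_iff.1 hj h

/-- The image of that coordinate map is the image of the corresponding block. -/
lemma map_lapply_blockChain (i : o.ToType) :
    (blockChain π f (Order.succ (i.toOrd : Ordinal))).map
        (Finsupp.lapply i ∘ₗ (blockSum π f Set.univ).subtype) =
      (block π f i).map (Finsupp.lapply i) := by
  rw [Submodule.map_comp, blockChain, preimage_toOrd_Iio_succ, Submodule.submoduleOf,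
    Submodule.map_comap_subtype, inf_eq_right.2 (blockSum_mono (Set.subset_univ _)),
    map_lapply_blockSum_Iic]

end Chain

/-! ### Extending maps to the sum of all blocks -/

section Extension

variable {R : Type*} [CommRing R] {F W : Type*} [AddCommGroup F] [Module R F]
  [AddCommGroup W] [Module R W] {κ : Cardinal.{u}} {π : κ.ord.ToType → F →ₗ[R] W}
  {f : κ.ord.ToType → F →ₗ[R] (κ.ord.ToType →₀ W)}

/-- A linear map from the kernel of `p` to the sum of all blocks extends to `F` if each of its
extensions to a map from `F` to the injective ambient module occurs, together with `p`, at
arbitrarily large indices. -/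
lemma exists_extension_of_frequently [Countable F] (hκ : κ.IsRegular) (hlt : ℵ₀ < κ)
    (hV : Module.Baer R (κ.ord.ToType →₀ W)) (p : F →ₗ[R] W)
    (hfreq : ∀ g α, ∃ β, α ≤ β ∧ π β = p ∧ f β = g) {N : Submodule R F}
    (hN : LinearMap.ker p = N) (g : N →ₗ[R] blockSum π f Set.univ) :
    ∃ g' : F →ₗ[R] blockSum π f Set.univ, g' ∘ₗ N.subtype = g := by
  obtain ⟨h, hh⟩ := hV.extension_property N.subtype N.subtype_injective
    ((blockSum π f Set.univ).subtype ∘ₗ g)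
  have hval : ∀ x : N, h x = g x := fun x => DFunLike.congr_fun hh x
  have hsupp : ∃ α, ∀ x, ∀ i ∈ (h x).support, i < α := by
    obtain ⟨α, hα⟩ := exists_forall_lt_of_countable hκ hlt
      (s := ⋃ x, ((h x).support : Set κ.ord.ToType))
      (Set.countable_iUnion fun x => (h x).support.countable_toSet)
    exact ⟨α, fun x i hi => hα i (Set.mem_iUnion.2 ⟨x, hi⟩)⟩
  obtain ⟨α, hα⟩ := hsupp
  obtain ⟨β, hαβ, hπ, hf⟩ := hfreq h α
  have hsuppβ : ∀ x, h x ∈ Finsupp.supported W R (Set.Iio β) := fun x =>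
    (Finsupp.mem_supported R _).2 fun i hi => (hα x i hi).trans_le hαβ
  have hv : IsValid π f β := by
    refine ⟨fun x => hf ▸ hsuppβ x, fun x hx => ?_⟩
    rw [hf]
    rw [hπ, ← LinearMap.mem_ker, hN] at hx
    refine mem_blockSum_of_mem_supported (isLowerSet_Iio β) (t := Set.univ) ?_ (hsuppβ x)
    rw [hval ⟨x, hx⟩]
    exact Subtype.property _
  refine ⟨(h + Finsupp.lsingle β ∘ₗ p).codRestrict _ fun x => ?_,
    LinearMap.ext fun x => Subtype.ext ?_⟩
  · refine block_le_blockSum (Set.mem_univ β) ?_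
    rw [block_eq_range hv, hf, hπ]
    exact ⟨x, rfl⟩
  · have hx : p x = 0 := by rw [← LinearMap.mem_ker, hN]; exact x.2
    simp [hx, hval]

end Extension

/-! ### The free summands and the construction -/

section RankOne

variable {R : Subring ℚ} {I : Type*} {F : Type*} [AddCommGroup F] [Module R F]
  [LinearOrder I] [WellFoundedLT I] {π : I → F →ₗ[R] (ℕ →₀ ℚ)}
  {f : I → F →ₗ[R] (I →₀ ℕ →₀ ℚ)}

/-- The vector with the single coordinate `1` at `(β, 0)` is divisible only by units of `R` when
block `β` adds a free module generated by it. -/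
lemma inv_mem_of_nsmul_eq_single {β : I} (hv : IsValid π f β)
    (hπ : LinearMap.range (π β) = Submodule.span R {Finsupp.single 0 1})
    {m : ℕ} (hm : m ≠ 0) {x : I →₀ ℕ →₀ ℚ} (hx : x ∈ blockSum π f Set.univ)
    (hmx : m • x = Finsupp.single β (Finsupp.single 0 1)) : ((m : ℚ))⁻¹ ∈ R := by
  have hmem : x ∈ blockSum π f (Set.Iic β) := by
    refine mem_blockSum_of_mem_supported (isLowerSet_Iic β) hx ?_
    rw [Finsupp.mem_supported]
    intro i hi
    by_contra hne
    have hiβ : β ≠ i := fun h => hne h.ge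
    have h := DFunLike.congr_fun hmx i
    rw [Finsupp.single_eq_of_ne hiβ.symm, Finsupp.smul_apply, smul_eq_zero] at h
    exact Finsupp.mem_support_iff.1 hi (h.resolve_left hm)
  have hβ : x β ∈ LinearMap.range (π β) := by
    rw [← map_lapply_block hv, ← map_lapply_blockSum_Iic]
    exact ⟨x, hmem, rfl⟩
  rw [hπ, Submodule.mem_span_singleton] at hβ
  obtain ⟨r, hr⟩ := hβ
  have h := DFunLike.congr_fun (DFunLike.congr_fun hmx β) 0
  rw [Finsupp.smul_apply, ← hr] at h
  simp [Subring.smul_def] at h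
  rw [← eq_inv_of_mul_eq_one_right h]
  exact r.2

end RankOne

theorem theorem4p6 (R : Subring ℚ) (hR : R ≠ ⊤)
    (Φ : Set (ModuleCat.{u} R)) (hne : Φ.Nonempty)
    (hΦ : ∀ M ∈ Φ, ∃ n : ℕ, IsFreeByOne R n M)
    (κ : Cardinal.{u}) (hκ : κ.IsRegular) (hΦκ : #Φ < Cardinal.lift.{u + 1} κ)
    (hpow : κ ^ ℵ₀ = κ) :
    ∃ G : ModuleCat.{u} R,
      Module.IsTorsionFree R G ∧ Module.rank R G = κ ∧ IsNucleus R G ∧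
      IsPhiComplete R Φ G ∧ IsPhiRepresented R Φ G ∧
      ∀ n : ℕ, (∀ M ∈ Φ, (n : Cardinal.{u}) + 1 ≤ Module.rank R M ∧ IsNFree R n M) →
        IsNFree R n G := by
  have hlt := aleph0_lt_of_power_aleph0_eq hκ hpow
  have hV : #(κ.ord.ToType →₀ ℕ →₀ ℚ) = κ := mk_finsupp_countable hκ.aleph0_le
  have hsurj : ∀ M : Φ, ∃ (q : (ULift.{u} ℕ →₀ R) →ₗ[R] M.1) (j : M.1 →ₗ[R] (ℕ →₀ ℚ)),
      Function.Surjective q ∧ Function.Injective j := fun M =>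
    (hΦ M.1 M.2).elim fun n h => h.exists_surjective_injective
  choose q j hq hj using hsurj
  -- `none` stands for the free module of rank one
  obtain ⟨τ, hτ⟩ := exists_forall_exists_ge_eq hκ.aleph0_le
    (T := Option Φ × (ℕ → κ.ord.ToType →₀ ℕ →₀ ℚ))
    (lift_mk_option_prod_le hκ.aleph0_le hpow (by rwa [Cardinal.lift_id'.{u, u + 1}]) hV)
  let p₀ : (ULift.{u} ℕ →₀ R) →ₗ[R] (ℕ →₀ ℚ) :=
    LinearMap.toSpanSingleton R (ℕ →₀ ℚ) (Finsupp.single 0 1) ∘ₗ Finsupp.lapply ⟨0⟩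
  let φ : Option Φ → (ULift.{u} ℕ →₀ R) →ₗ[R] (ℕ →₀ ℚ) := fun t =>
    t.elim p₀ fun M => j M ∘ₗ q M
  let π : κ.ord.ToType → (ULift.{u} ℕ →₀ R) →ₗ[R] (ℕ →₀ ℚ) := fun β => φ (τ β).1
  let f : κ.ord.ToType → (ULift.{u} ℕ →₀ R) →ₗ[R] (κ.ord.ToType →₀ ℕ →₀ ℚ) := fun β =>
    Finsupp.linearCombination R fun l => (τ β).2 l.down
  have hp₀ : LinearMap.range p₀ = Submodule.span R {Finsupp.single 0 1} := by
    have hs : Function.Surjective (Finsupp.lapply ⟨0⟩ : (ULift.{u} ℕ →₀ R) →ₗ[R] R) := fun r =>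
      ⟨Finsupp.single ⟨0⟩ r, by simp⟩
    rw [LinearMap.range_comp, LinearMap.range_eq_top.2 hs, Submodule.map_top,
      LinearMap.range_toSpanSingleton]
  have he₀ : (Finsupp.single 0 1 : ℕ →₀ ℚ) ≠ 0 := by simp
  have hfree : Nonempty (R ≃ₗ[R] LinearMap.range p₀) := by
    rw [hp₀]
    exact ⟨LinearEquiv.toSpanNonzeroSingleton R _ _ he₀⟩
  have hmem : ∀ M : Φ, Nonempty (LinearMap.range (φ (some M)) ≃ₗ[R] M.1) := fun M =>
    nonempty_range_comp_equiv (q M) (j M) (hq M) (hj M)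
  -- `J` consists of the indices at which a free summand is split off. The zero map is
  -- valid at every index, so `J` is cofinal and has `κ` elements.
  let J : Set κ.ord.ToType := {β | τ β = (none, 0)}
  have hJπ : ∀ β ∈ J, π β = p₀ := fun β hβ => by
    simp only [π, show τ β = (none, 0) from hβ]; rfl
  have hJf : ∀ β ∈ J, f β = 0 := fun β hβ => by
    simp only [f, show τ β = (none, 0) from hβ]
    ext; simp
  have hJv : ∀ β ∈ J, IsValid π f β := fun β hβ => by
    refine ⟨fun x => ?_, fun x _ => ?_⟩ <;> rw [hJf β hβ] <;> exact zero_mem _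
  have hJsingle : ∀ β ∈ J, Finsupp.single β (Finsupp.single 0 1) ∈ blockSum π f Set.univ :=
    fun β hβ => by
      refine block_le_blockSum (Set.mem_univ β) ?_
      rw [block_eq_range (hJv β hβ), hJf β hβ, hJπ β hβ]
      exact ⟨Finsupp.single ⟨0⟩ 1, by simp [p₀]⟩
  have hJcof : IsCofinal J := fun α => (hτ (none, 0) α).elim fun β h => ⟨β, h.2, h.1⟩
  refine ⟨ModuleCat.of R (blockSum π f Set.univ), ?_, ?_, ?_, ?_, ?_, ?_⟩
  · change Module.IsTorsionFree R (blockSum π f Set.univ)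
    infer_instance
  · change Module.rank R (blockSum π f Set.univ) = κ
    refine le_antisymm ((rank_le_card R _).trans ((Cardinal.mk_subtype_le _).trans hV.le)) ?_
    have hcard : κ ≤ #J := by
      have := Order.cof_le hJcof
      rwa [Ordinal.cof_toType, hκ.cof_ord] at this
    have hli : LinearIndependent R fun β : J =>
        (⟨_, hJsingle β.1 β.2⟩ : blockSum π f Set.univ) := by
      refine LinearIndependent.of_comp (blockSum π f Set.univ).subtype ?_
      exact (Finsupp.linearIndependent_single_of_ne_zero (R := R)
        (v := fun _ : κ.ord.ToType => (Finsupp.single 0 1 : ℕ →₀ ℚ)) fun _ => he₀).comp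
          Subtype.val Subtype.val_injective
    exact hcard.trans hli.cardinal_le_rank
  · have : Nonempty κ.ord.ToType := ⟨(hτ (none, 0)
      (Ordinal.ToType.mk ⟨0, (Cardinal.isSuccLimit_ord hκ.aleph0_le).bot_lt⟩)).choose⟩
    obtain ⟨β, hβ⟩ : J.Nonempty := hJcof.nonempty
    refine isNucleus_of_divisors R (⟨_, hJsingle β hβ⟩ : blockSum π f Set.univ) fun m x hm hx => ?_
    exact inv_mem_of_nsmul_eq_single (hJv β hβ) (by rw [hJπ β hβ, hp₀]) hm x.2
      (congrArg Subtype.val hx)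
  · intro M hM
    refine subsingleton_ext_one_of_extension M _ (q ⟨M, hM⟩) (hq ⟨M, hM⟩) fun g => ?_
    refine exists_extension_of_frequently hκ hlt (baer_of_rat_module R _)
      (φ (some ⟨M, hM⟩)) (fun h α => ?_) ?_ g
    · obtain ⟨β, hαβ, hβ⟩ := hτ (some ⟨M, hM⟩, fun l => h (Finsupp.single ⟨l⟩ 1)) α
      refine ⟨β, hαβ, by simp only [π, hβ], ?_⟩
      simp only [f, hβ]
      ext; simp
    · exact LinearMap.ker_comp_of_ker_eq_bot _ (LinearMap.ker_eq_bot.2 (hj ⟨M, hM⟩))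
  · refine ⟨κ.ord, blockChain π f, monotone_blockChain, blockChain_zero, ?_,
      fun δ _ hδ => blockChain_eq_iSup hδ, fun α hα => ?_⟩
    · rw [← blockChain_eq_iSup (Cardinal.isSuccLimit_ord hκ.aleph0_le), blockChain_eq_top]
    · obtain ⟨i, rfl⟩ : ∃ i : κ.ord.ToType, (i.toOrd : Ordinal) = α :=
        ⟨Ordinal.ToType.mk ⟨α, (Order.lt_succ α).trans hα⟩, by simp⟩
      obtain ⟨e⟩ := nonempty_quotient_submoduleOf_equiv_map
        (V := ModuleCat.of R (blockSum π f Set.univ))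
        (A := blockChain π f (i.toOrd : Ordinal))
        (B := blockChain π f (Order.succ (i.toOrd : Ordinal)))
        (Finsupp.lapply i ∘ₗ (blockSum π f Set.univ).subtype)
        fun x hx => lapply_eq_zero_iff_mem_blockChain i hx
      rw [map_lapply_blockChain] at e
      by_cases hv : IsValid π f i
      · rw [map_lapply_block hv] at e
        rcases ht : (τ i).1 with _ | M
        · left
          obtain ⟨e'⟩ := hfree
          have hi : π i = p₀ := by simp only [π, ht]; rfl
          rw [hi] at e
          exact Module.Free.of_equiv (e'.trans e.symm)
        · right
          obtain ⟨e'⟩ := hmem M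
          have hi : π i = φ (some M) := by simp only [π, ht]
          rw [hi] at e
          exact ⟨M.1, M.2, ⟨e.trans e'⟩⟩
      · left
        rw [block_eq_bot hv, Submodule.map_bot] at e
        exact Module.Free.of_equiv e.symm
  · intro n hn N hN
    change Submodule R (blockSum π f Set.univ) at N
    have e := (blockSum π f Set.univ).equivSubtypeMap N
    have : Module.Free R (N.map (blockSum π f Set.univ).subtype) := by
      refine free_of_rank_le_of_le_blockSum (n := n) (fun α => ?_) _
        (Submodule.map_subtype_le _ _) (e.rank_eq.symm.le.trans hN)
      rcases ht : (τ α).1 with _ | M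
      · obtain ⟨e'⟩ := hfree
        have hi : π α = p₀ := by simp only [π, ht]; rfl
        rw [hi]
        exact (isNFree_self n).of_equiv e'
      · obtain ⟨e'⟩ := hmem M
        have hi : π α = φ (some M) := by simp only [π, ht]
        rw [hi]
        exact (hn M.1 M.2).2.of_equiv e'.symm
    exact Module.Free.of_equiv e.symm
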